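/- Let $\Sigma=\{a,b\}$. Call a morphism $f:\Sigma^*\to\Sigma^*$ prolongable on $a$ if it is nonerasing ($f(a)\neq\varepsilon$ and $f(b)\neq\varepsilon$) and $f(a)=au$ for some nonempty word $u\in\Sigma^*$; then $f^{\omega}(a)$ denotes the unique infinite word that has $f^k(a)$ as a prefix for every $k\ge 0$. Call an infinite word $s=s_0s_1s_2\cdots$ over $\Sigma$ purely abelian periodic if there is an integer $p\ge 1$ such that, for every $k\ge 0$, the words $s_0\cdots s_{p-1}$ and $s_{kp}\cdots s_{(k+1)p-1}$ contain each letter the same number of times. Pure abelian periodicity is decidable for words generated by binary morphisms: there is an algorithm (a total computable function) which, given the pair of words $(f(a),f(b))$ of any morphism $f:\Sigma^*\to\Sigma^*$ prolongable on $a$, decides whether the infinite word $f^{\omega}(a)$ is purely abelian periodic. -/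

import Mathlib

/-- The binary alphabet `{a, b}`, coded by the two Booleans. -/
abbrev Letter : Type := Bool

namespace Letter

/-- The letter `a`. -/
abbrev a : Letter := false

/-- The letter `b`. -/
abbrev b : Letter := true

end Letter

/-- A finite word over `{a, b}`: an element of the free monoid. -/
abbrev Word : Type := FreeMonoid Letter

/-- A morphism `{a, b}* → {a, b}*` preserves concatenation (and hence the empty word). -/
abbrev Morphism : Type := Word →* Word

/-- The morphism is nonerasing: no letter has an empty image. -/
def IsNonerasing (f : Morphism) : Prop :=
  ∀ c : Letter, f (FreeMonoid.of c) ≠ 1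

/-- `f` is prolongable on `a`: it is nonerasing and `f(a) = au` with `u` nonempty. -/
def IsProlongable (f : Morphism) : Prop :=
  IsNonerasing f ∧ ∃ u : Word, u ≠ 1 ∧ f (FreeMonoid.of Letter.a) = FreeMonoid.of Letter.a * u

/-- The finite word `w` is a prefix of the infinite word `s`. -/
def IsPrefixOfInfinite (w : Word) (s : ℕ → Letter) : Prop :=
  ∀ i : ℕ, i < w.toList.length → w.toList[i]? = some (s i)

/-- The infinite word `f^ω(a)`: its `n`-th letter is the `n`-th letter of `f^n(a)`. For `f`
prolongable on `a` this is the unique infinite word with all the words `f^k(a)` as prefixes,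
see `omegaWord_prefix` and `omegaWord_unique`; the default letter is then never used. -/
def omegaWord (f : Morphism) (n : ℕ) : Letter :=
  (f^[n] (FreeMonoid.of Letter.a)).toList.getD n Letter.a

/-- Two finite words are abelian equivalent: each letter occurs equally often in both. -/
def AbelianEquivalent (u v : List Letter) : Prop :=
  ∀ c : Letter, u.count c = v.count c

/-- The factor `s_i s_{i+1} ⋯ s_{i+l-1}` of an infinite word. -/
def infiniteFactor (s : ℕ → Letter) (i l : ℕ) : List Letter :=
  (List.range l).map fun j => s (i + j)

/-- `s` is abelian periodic with period `p ≥ 1` and preperiod `r`. -/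
def IsAbelianPeriodicWith (s : ℕ → Letter) (p r : ℕ) : Prop :=
  0 < p ∧ ∀ k : ℕ, AbelianEquivalent (infiniteFactor s r p) (infiniteFactor s (r + k * p) p)

/-- `s` is purely abelian periodic: abelian periodic with preperiod `0`. -/
def IsPurelyAbelianPeriodic (s : ℕ → Letter) : Prop :=
  ∃ p : ℕ, IsAbelianPeriodicWith s p 0

/-- The finite data `(f(a), f(b))` by which a morphism is given to an algorithm. -/
def blocks (f : Morphism) : List Letter × List Letter :=
  ((f (FreeMonoid.of Letter.a)).toList, (f (FreeMonoid.of Letter.b)).toList)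

theorem IsNonerasing.iterate_ne_one {f : Morphism} (hf : IsNonerasing f) (k : ℕ) {w : Word}
    (hw : w ≠ 1) : f^[k] w ≠ 1 := by
  induction k generalizing w with
  | zero => simpa using hw
  | succ k ih =>
    rw [Function.iterate_succ_apply]
    apply ih
    induction w using FreeMonoid.casesOn with
    | one => exact absurd rfl hw
    | of_mul c w =>
      intro h
      rw [map_mul] at h
      have h' := congrArg FreeMonoid.length h
      rw [FreeMonoid.length_mul, FreeMonoid.length_one] at h'
      exact hf c (FreeMonoid.length_eq_zero.1 (by omega))

theorem IsProlongable.exists_iterate_succ {f : Morphism} (hf : IsProlongable f) (k : ℕ) :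
    ∃ v : Word, v ≠ 1 ∧
      f^[k + 1] (FreeMonoid.of Letter.a) = f^[k] (FreeMonoid.of Letter.a) * v := by
  obtain ⟨h, u, hu, hfu⟩ := hf
  refine ⟨f^[k] u, h.iterate_ne_one k hu, ?_⟩
  rw [Function.iterate_succ_apply, hfu, iterate_map_mul]

theorem IsProlongable.lt_length {f : Morphism} (hf : IsProlongable f) (k : ℕ) :
    k < (f^[k] (FreeMonoid.of Letter.a)).toList.length := by
  induction k with
  | zero => exact Nat.zero_lt_one
  | succ k ih =>
    obtain ⟨v, hv, h⟩ := hf.exists_iterate_succ k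
    have hv' : v.toList.length ≠ 0 := fun h0 => hv (FreeMonoid.length_eq_zero.1 h0)
    rw [h, FreeMonoid.toList_mul, List.length_append]
    omega

theorem IsProlongable.iterate_prefix {f : Morphism} (hf : IsProlongable f) {k l : ℕ}
    (h : k ≤ l) :
    (f^[k] (FreeMonoid.of Letter.a)).toList <+: (f^[l] (FreeMonoid.of Letter.a)).toList := by
  induction l, h using Nat.le_induction with
  | base => exact List.prefix_refl _
  | succ l _ ih =>
    obtain ⟨v, _, h⟩ := hf.exists_iterate_succ l
    rw [h, FreeMonoid.toList_mul]
    exact ih.trans (List.prefix_append _ _)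

/-- Every `f^k(a)` is a prefix of `f^ω(a)`. -/
theorem omegaWord_prefix {f : Morphism} (hf : IsProlongable f) (k : ℕ) :
    IsPrefixOfInfinite (f^[k] (FreeMonoid.of Letter.a)) (omegaWord f) := by
  intro i hi
  have hi' := hf.lt_length i
  have hs : (f^[i] (FreeMonoid.of Letter.a)).toList[i]? = some (omegaWord f i) := by
    rw [omegaWord, List.getD_eq_getElem _ _ hi', List.getElem?_eq_getElem hi']
  rw [← hs]
  rcases le_total k i with h | h
  · obtain ⟨t, ht⟩ := hf.iterate_prefix h
    rw [← ht, List.getElem?_append_left hi]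
  · obtain ⟨t, ht⟩ := hf.iterate_prefix h
    rw [← ht, List.getElem?_append_left hi']

/-- `f^ω(a)` is the only infinite word with all the words `f^k(a)` as prefixes. -/
theorem omegaWord_unique {f : Morphism} (hf : IsProlongable f) {s : ℕ → Letter}
    (hs : ∀ k, IsPrefixOfInfinite (f^[k] (FreeMonoid.of Letter.a)) s) : s = omegaWord f := by
  funext i
  have h1 := hs i i (hf.lt_length i)
  have h2 := omegaWord_prefix hf i i (hf.lt_length i)
  exact Option.some.inj (h1.symm.trans h2)

/-! Let p be an abelian period, (X, Y) the letter counts of the prefix of length p, and W the linear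
weight vanishing on (X, Y). Then W is zero at multiples of p, hence bounded on all prefixes.

Suppose the matrix of f is nonsingular and Y > 0. Boundedness forces W∘f = ±W, so f² preserves W.
Images under powers of f² let the weight in front of an occurrence of a be accumulated, so it must
be zero (`weight_eq_zero_of_bounded`). Then W never becomes negative, a stands exactly where W is
zero, and W determines the continuation: the word is truly periodic, with a period bounded by
|f²(a)| (`exists_period`). For Y = 0 the word is constant. That q is a period is equivalent to the
word equation f(z)^q = z^|f(z)|, where z is the prefix of length q.

Suppose the matrix is singular. All count vectors of images are multiples of that of f(a), so the
weight `disc` vanishes on images, and its value on a prefix depends only on where the prefix ends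
inside the image of a letter. The abelian periods are the p > 0 with `disc` zero at all multiples of
p. A given p is tested on f^(2p+1)(a) by a finite-state argument (`disc_eq_zero_of_forall_le`), and
some p below an explicit bound works if any does (`exists_disc_eq_zero_le`). Both cases thus become
bounded searches. -/

/-- The action on words of the morphism with letter images `h`. -/
def substWord (h : Letter → List Letter) (w : List Letter) : List Letter := w.flatMap h

/-- The word `f^k(a)`, where `f` is the morphism with letter images `h`. -/
def iterWord (h : Letter → List Letter) (k : ℕ) : List Letter := (substWord h)^[k] [false]

/-- The prefix of length `n` of an infinite word. -/
def pre (s : ℕ → Letter) (n : ℕ) : List Letter := (List.range n).map s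

/-- The infinite word `s` is generated by the prolongable morphism with letter images `h`. -/
structure Generates (h : Letter → List Letter) (s : ℕ → Letter) : Prop where
  head : ∃ u, u ≠ [] ∧ h false = false :: u
  nonerasing : h true ≠ []
  isPre : ∀ k, iterWord h k = pre s (iterWord h k).length

/-! ### Prefixes of infinite words -/

section Prefixes

variable {s : ℕ → Letter}

@[simp] theorem length_pre (n : ℕ) : (pre s n).length = n := by simp [pre]

@[simp] theorem pre_zero : pre s 0 = [] := rfl

theorem pre_succ (n : ℕ) : pre s (n + 1) = pre s n ++ [s n] := by
  simp [pre, List.range_succ]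

theorem pre_add (m n : ℕ) : pre s (m + n) = pre s m ++ pre (fun i => s (m + i)) n := by
  simp [pre, List.range_add, List.map_append, Function.comp_def]

theorem infiniteFactor_eq_pre (i l : ℕ) : infiniteFactor s i l = pre (fun j => s (i + j)) l := rfl

theorem take_pre {m n : ℕ} (hmn : m ≤ n) : (pre s n).take m = pre s m := by
  obtain ⟨d, rfl⟩ := Nat.exists_eq_add_of_le hmn
  rw [pre_add, List.take_append_of_le_length (by simp)]
  exact List.take_of_length_le (by simp)

theorem pre_prefix {m n : ℕ} (hmn : m ≤ n) : pre s m <+: pre s n :=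
  take_pre (s := s) hmn ▸ List.take_prefix _ _

theorem eq_pre_of_prefix {w : List Letter} {n : ℕ} (hw : w <+: pre s n) :
    w = pre s w.length := by
  have hl : w.length ≤ n := by simpa using hw.length_le
  rw [← take_pre hl]
  exact List.prefix_iff_eq_take.1 hw

theorem pre_inj_letter {n : ℕ} {w : List Letter} {x : Letter} (hw : w ++ [x] = pre s (n + 1)) :
    w = pre s n ∧ x = s n := by
  rw [pre_succ] at hw
  have h := List.append_inj' hw rfl
  exact ⟨h.1, by simpa using h.2⟩

theorem eq_pre_concat {w : List Letter} {x : Letter}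
    (hw : w ++ [x] = pre s (w ++ [x]).length) : w = pre s w.length ∧ x = s w.length := by
  rw [List.length_append, List.length_singleton] at hw
  exact pre_inj_letter hw

end Prefixes

/-! ### Substitutions and letter counts -/

section Substitution

variable {h : Letter → List Letter}

@[simp] theorem substWord_nil : substWord h [] = [] := rfl

@[simp] theorem substWord_append (u v : List Letter) :
    substWord h (u ++ v) = substWord h u ++ substWord h v := by
  simp [substWord]

@[simp] theorem substWord_cons (x : Letter) (v : List Letter) :
    substWord h (x :: v) = h x ++ substWord h v := by
  simp [substWord]

theorem iterate_substWord_append (k : ℕ) (u v : List Letter) :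
    (substWord h)^[k] (u ++ v) = (substWord h)^[k] u ++ (substWord h)^[k] v := by
  induction k generalizing u v with
  | zero => rfl
  | succ k ih => simp only [Function.iterate_succ_apply, substWord_append, ih]

theorem substWord_prefix {u v : List Letter} (huv : u <+: v) :
    substWord h u <+: substWord h v := by
  obtain ⟨t, rfl⟩ := huv
  rw [substWord_append]
  exact List.prefix_append _ _

theorem iterate_substWord_prefix (k : ℕ) {u v : List Letter} (huv : u <+: v) :
    (substWord h)^[k] u <+: (substWord h)^[k] v := by
  obtain ⟨t, rfl⟩ := huv
  rw [iterate_substWord_append]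
  exact List.prefix_append _ _

theorem iterWord_succ (k : ℕ) : iterWord h (k + 1) = substWord h (iterWord h k) := by
  rw [iterWord, Function.iterate_succ_apply', iterWord]

theorem iterWord_add (k l : ℕ) : iterWord h (k + l) = (substWord h)^[k] (iterWord h l) := by
  rw [iterWord, Function.iterate_add_apply, iterWord]

@[simp] theorem iterWord_zero : iterWord h 0 = [false] := rfl

theorem iterWord_one : iterWord h 1 = h false := by
  simp [iterWord_succ]

theorem count_substWord (c : Letter) (w : List Letter) :
    (substWord h w).count c =
      w.count false * (h false).count c + w.count true * (h true).count c := by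
  induction w with
  | nil => simp
  | cons x w ih =>
    rw [substWord_cons, List.count_append, ih, List.count_cons, List.count_cons]
    cases x <;> simp only [beq_self_eq_true, if_true, reduceCtorEq, beq_iff_eq, if_false] <;> ring

theorem length_eq_count (w : List Letter) : w.length = w.count false + w.count true := by
  induction w with
  | nil => rfl
  | cons x w ih => cases x <;> simp only [List.length_cons, List.count_cons, ih] <;> simp <;> omega

theorem length_substWord (w : List Letter) :
    (substWord h w).length = w.count false * (h false).length + w.count true * (h true).length := by
  rw [length_eq_count, count_substWord, count_substWord, length_eq_count (h false),
    length_eq_count (h true)]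
  ring

/-- A prefix of `f(w)` shorter than `f(w)` ends inside the image of a letter of `w`. -/
theorem exists_prefix_substWord {w : List Letter} {n : ℕ} (hn : n < (substWord h w).length) :
    ∃ u x i, u ++ [x] <+: w ∧ i < (h x).length ∧ n = (substWord h u).length + i ∧
      (substWord h w).take n = substWord h u ++ (h x).take i := by
  induction w using List.reverseRecOn with
  | nil => simp at hn
  | append_singleton w x ih =>
    by_cases hlt : n < (substWord h w).length
    · obtain ⟨u, y, i, hu, hi, hni, ht⟩ := ih hlt
      refine ⟨u, y, i, hu.trans (List.prefix_append _ _), hi, hni, ?_⟩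
      rw [substWord_append, List.take_append_of_le_length hlt.le, ht]
    · push Not at hlt
      obtain ⟨i, rfl⟩ := Nat.exists_eq_add_of_le hlt
      refine ⟨w, x, i, List.prefix_rfl, ?_, rfl, ?_⟩
      · simpa using hn
      · simp [List.take_append]

end Substitution

/-! ### Structure of the generated word -/

namespace Generates

variable {h : Letter → List Letter} {s : ℕ → Letter}

theorem iterWord_eq_cons (H : Generates h s) (k : ℕ) : ∃ t, iterWord h k = false :: t := by
  induction k with
  | zero => exact ⟨[], rfl⟩
  | succ k ih =>
    obtain ⟨t, ht⟩ := ih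
    obtain ⟨u, -, hu⟩ := H.head
    exact ⟨u ++ substWord h t, by rw [iterWord_succ, ht, substWord_cons, hu]; rfl⟩

theorem length_image_pos (H : Generates h s) (x : Letter) : 0 < (h x).length := by
  cases x
  · obtain ⟨u, -, hu⟩ := H.head
    simp [hu]
  · exact List.length_pos_iff.2 H.nonerasing

theorem length_le_substWord (H : Generates h s) (w : List Letter) :
    w.length ≤ (substWord h w).length := by
  rw [length_substWord, length_eq_count w]
  have h1 := H.length_image_pos false
  have h2 := H.length_image_pos true
  nlinarith [Nat.zero_le (w.count false), Nat.zero_le (w.count true)]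

theorem length_iterWord_lt_succ (H : Generates h s) (k : ℕ) :
    (iterWord h k).length < (iterWord h (k + 1)).length := by
  obtain ⟨t, ht⟩ := H.iterWord_eq_cons k
  obtain ⟨u, hu0, hu⟩ := H.head
  have h1 := H.length_le_substWord t
  have h2 := List.length_pos_iff.2 hu0
  rw [iterWord_succ, ht, substWord_cons, hu]
  simp
  omega

theorem strictMono_length (H : Generates h s) : StrictMono fun k => (iterWord h k).length :=
  strictMono_nat_of_lt_succ H.length_iterWord_lt_succ

theorem lt_length (H : Generates h s) (k : ℕ) : k < (iterWord h k).length := by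
  induction k with
  | zero => simp
  | succ k ih => exact lt_of_le_of_lt ih (H.length_iterWord_lt_succ k)

theorem iterWord_prefix (H : Generates h s) {k l : ℕ} (hkl : k ≤ l) :
    iterWord h k <+: iterWord h l := by
  rw [H.isPre k, H.isPre l]
  exact pre_prefix (H.strictMono_length.monotone hkl)

theorem pre_prefix_iterWord (H : Generates h s) {n k : ℕ} (hn : n ≤ (iterWord h k).length) :
    pre s n <+: iterWord h k := by
  rw [H.isPre k]
  exact pre_prefix hn

theorem take_iterWord (H : Generates h s) {n k : ℕ} (hn : n ≤ (iterWord h k).length) :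
    (iterWord h k).take n = pre s n := by
  rw [H.isPre k, take_pre hn]

/-- A prefix of the word is a prefix of some f^l(a), and f^k maps this into f^(k+l)(a). -/
theorem eq_pre_iterate (H : Generates h s) (k : ℕ) {w : List Letter} (hw : w = pre s w.length) :
    (substWord h)^[k] w = pre s ((substWord h)^[k] w).length := by
  have h1 : w <+: iterWord h w.length := by
    rw [hw, length_pre]
    exact H.pre_prefix_iterWord (H.lt_length _).le
  have h2 := iterate_substWord_prefix (h := h) k h1
  rw [← iterWord_add, H.isPre] at h2
  exact eq_pre_of_prefix h2

theorem eq_pre_substWord (H : Generates h s) {w : List Letter} (hw : w = pre s w.length) :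
    substWord h w = pre s (substWord h w).length :=
  H.eq_pre_iterate 1 hw

theorem apply_zero (H : Generates h s) : s 0 = false := by
  have := H.isPre 0
  simpa [pre] using this.symm

/-- Every position of the generated word lies inside the image of one of its letters. -/
theorem exists_position (H : Generates h s) (n : ℕ) :
    ∃ u x i, u ++ [x] = pre s (u ++ [x]).length ∧ i < (h x).length ∧
      n = (substWord h u).length + i ∧ pre s n = substWord h u ++ (h x).take i := by
  have hn : n < (substWord h (iterWord h n)).length :=
    lt_of_lt_of_le (H.lt_length n) (H.length_le_substWord _)
  obtain ⟨u, x, i, hu, hi, hni, ht⟩ := exists_prefix_substWord hn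
  refine ⟨u, x, i, eq_pre_of_prefix (n := (iterWord h n).length) (H.isPre n ▸ hu), hi, hni, ?_⟩
  rw [← ht, ← iterWord_succ, H.take_iterWord]
  rw [iterWord_succ]
  exact hn.le

end Generates

/-- Pure abelian periodicity in terms of the letter counts of prefixes. -/
theorem isAbelianPeriodicWith_zero_iff (s : ℕ → Letter) (p : ℕ) :
    IsAbelianPeriodicWith s p 0 ↔
      0 < p ∧ ∀ k c, (pre s (k * p)).count c = k * (pre s p).count c := by
  refine and_congr_right fun _ => ⟨fun H k c => ?_, fun H k c => ?_⟩
  · induction k with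
    | zero => simp
    | succ k ih =>
      have := H k c
      rw [infiniteFactor_eq_pre, infiniteFactor_eq_pre] at this
      simp only [zero_add] at this
      rw [Nat.succ_mul, pre_add, List.count_append, ih, ← this, Nat.succ_mul]
  · have h1 := H (k + 1) c
    rw [Nat.succ_mul, pre_add, List.count_append, H k c, Nat.succ_mul] at h1
    rw [infiniteFactor_eq_pre, infiniteFactor_eq_pre]
    simp only [zero_add]
    change (pre s p).count c = _
    omega

/-! ### Powers of words and true periodicity -/

/-- The `n`-th power of a word. -/
def listPow (z : List Letter) (n : ℕ) : List Letter := (List.replicate n z).flatten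

section Powers

@[simp] theorem listPow_zero (z : List Letter) : listPow z 0 = [] := rfl

theorem listPow_succ (z : List Letter) (n : ℕ) : listPow z (n + 1) = z ++ listPow z n := by
  simp [listPow, List.replicate_succ]

theorem listPow_add (z : List Letter) (m n : ℕ) :
    listPow z (m + n) = listPow z m ++ listPow z n := by
  rw [listPow, List.replicate_add, List.flatten_append]
  rfl

theorem listPow_mul (z : List Letter) (m n : ℕ) :
    listPow z (m * n) = listPow (listPow z m) n := by
  induction n with
  | zero => rfl
  | succ n ih => rw [Nat.mul_succ, Nat.add_comm, listPow_add, ih, listPow_succ]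

theorem length_listPow (z : List Letter) (n : ℕ) : (listPow z n).length = n * z.length := by
  simp [listPow]

theorem count_listPow (z : List Letter) (n : ℕ) (c : Letter) :
    (listPow z n).count c = n * z.count c := by
  induction n with
  | zero => simp
  | succ n ih => rw [listPow_succ, List.count_append, ih]; ring

theorem substWord_listPow (h : Letter → List Letter) (z : List Letter) (n : ℕ) :
    substWord h (listPow z n) = listPow (substWord h z) n := by
  induction n with
  | zero => rfl
  | succ n ih => rw [listPow_succ, listPow_succ, substWord_append, ih]

theorem pre_mul_of_periodic {s : ℕ → Letter} {q : ℕ} (hq : ∀ n, s (n + q) = s n) (m : ℕ) :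
    pre s (m * q) = listPow (pre s q) m := by
  induction m with
  | zero => simp
  | succ m ih =>
    rw [Nat.succ_mul, Nat.add_comm, pre_add, listPow_succ, ← ih]
    congr 2
    funext i
    rw [Nat.add_comm, hq]

theorem isPurelyAbelianPeriodic_of_periodic {s : ℕ → Letter} {q : ℕ} (hq0 : 0 < q)
    (hq : ∀ n, s (n + q) = s n) : IsPurelyAbelianPeriodic s := by
  refine ⟨q, (isAbelianPeriodicWith_zero_iff s q).2 ⟨hq0, fun k c => ?_⟩⟩
  rw [pre_mul_of_periodic hq, count_listPow]

end Powers

namespace Generates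

variable {h : Letter → List Letter} {s : ℕ → Letter}

/-- Raising to the power q makes the length of the image a multiple of q, so that this prefix is a
whole number of periods. -/
theorem listPow_eq_of_periodic (H : Generates h s) {q : ℕ} (hq : ∀ n, s (n + q) = s n) :
    listPow (substWord h (pre s q)) q = listPow (pre s q) (substWord h (pre s q)).length := by
  have h1 : listPow (pre s q) q = pre s (listPow (pre s q) q).length := by
    rw [length_listPow, length_pre, pre_mul_of_periodic hq]
  have h2 := H.eq_pre_substWord h1
  rw [substWord_listPow, length_listPow] at h2
  rw [h2, Nat.mul_comm, pre_mul_of_periodic hq]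

/-- Iterating the equation shows that some power of each f^k(z) is a power of z, so every prefix of
the word is a prefix of a power of z. -/
theorem periodic_of_listPow_eq (H : Generates h s) {q m : ℕ} (hq0 : 0 < q)
    (hq : listPow (substWord h (pre s q)) q = listPow (pre s q) m) (n : ℕ) :
    s (n + q) = s n := by
  obtain ⟨r, rfl⟩ := Nat.exists_eq_succ_of_ne_zero hq0.ne'
  set q := r + 1 with hqr
  set z := pre s q with hz
  have key : ∀ k, ∃ i M, listPow ((substWord h)^[k] z) (i + 1) = listPow z M := by
    intro k
    induction k with
    | zero => exact ⟨0, 1, rfl⟩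
    | succ k ih =>
      obtain ⟨i, M, hi⟩ := ih
      -- The new exponent is (i + 1)q, because f(z^M)^q = (f(z)^q)^M = z^(mM). Exponents are kept in
      -- successor form: they must be positive for f^k(a) to be a prefix of the power.
      refine ⟨i * q + r, m * M, ?_⟩
      have he : i * q + r + 1 = (i + 1) * q := by rw [hqr]; ring
      rw [he, Function.iterate_succ_apply', listPow_mul, ← substWord_listPow, hi,
        substWord_listPow, ← listPow_mul, Nat.mul_comm M q, listPow_mul, hq, ← listPow_mul]
  have hpre : ∀ k, ∃ M, pre s k <+: listPow z M := by
    intro k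
    obtain ⟨i, M, hi⟩ := key k
    refine ⟨M, hi ▸ ?_⟩
    have h0 : [false] <+: z := by
      have : pre s 1 <+: z := pre_prefix (Nat.succ_le_of_lt hq0)
      simpa [pre, H.apply_zero] using this
    refine (H.pre_prefix_iterWord (H.lt_length k).le).trans ?_
    rw [listPow_succ]
    exact (iterate_substWord_prefix k h0).trans (List.prefix_append _ _)
  obtain ⟨M, hM⟩ := hpre (q + (n + 1))
  have h1 : pre s (n + 1) <+: listPow z M := (pre_prefix (by omega)).trans hM
  have h2 : pre (fun i => s (q + i)) (n + 1) <+: listPow z M := by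
    cases M with
    | zero =>
      have := hM.length_le
      simp at this
    | succ M =>
      rw [pre_add, listPow_succ, List.prefix_append_right_inj] at hM
      refine hM.trans ?_
      rw [listPow_add]
      exact List.prefix_append _ _
  have h3 := (List.prefix_of_prefix_length_le h1 h2 (by simp)).eq_of_length (by simp)
  rw [pre_succ, pre_succ] at h3
  have h4 := (List.append_inj' h3 rfl).2
  simp only [List.cons.injEq, and_true] at h4
  rw [Nat.add_comm, ← h4]

end Generates

/-! ### Weights and boundedness -/

/-- The linear functional on letter counts that vanishes on the vector `(x, y)`. -/
def weight (x y : ℤ) (w : List Letter) : ℤ := y * w.count false - x * w.count true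

section Weight

variable {x y : ℤ}

@[simp] theorem weight_nil : weight x y [] = 0 := by simp [weight]

@[simp] theorem weight_append (u v : List Letter) :
    weight x y (u ++ v) = weight x y u + weight x y v := by
  simp only [weight, List.count_append]
  push_cast
  ring

@[simp] theorem weight_a : weight x y [false] = y := by simp [weight]

@[simp] theorem weight_b : weight x y [true] = -x := by simp [weight]

theorem weight_substWord (h : Letter → List Letter) (w : List Letter) :
    weight x y (substWord h w) =
      w.count false * weight x y (h false) + w.count true * weight x y (h true) := by
  simp only [weight, count_substWord]
  push_cast
  ring

theorem abs_weight_le (hx : 0 ≤ x) (hy : 0 ≤ y) (w : List Letter) :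
    |weight x y w| ≤ (x + y) * w.length := by
  rw [length_eq_count w, weight, abs_le]
  push_cast
  have h1 : (0 : ℤ) ≤ w.count false := by positivity
  have h2 : (0 : ℤ) ≤ w.count true := by positivity
  constructor <;> nlinarith [mul_nonneg hx h1, mul_nonneg hx h2, mul_nonneg hy h1, mul_nonneg hy h2]

theorem eq_zero_of_bounded_mul {e C : ℤ} (hC : ∀ k : ℕ, |k * e| ≤ C) : e = 0 := by
  by_contra he
  have h1 := hC (C.toNat + 1)
  have h2 : 1 ≤ |e| := Int.one_le_abs he
  have h3 : C ≤ C.toNat := Int.self_le_toNat C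
  rw [abs_mul, abs_of_nonneg (by positivity)] at h1
  push_cast at h1
  nlinarith

/-- A bounded geometric progression of nonzero integers has ratio `±1`. -/
theorem sq_eq_sq_of_bounded {r y C : ℤ} (hr : r ≠ 0) (hy : 0 < y) (z : ℕ → ℤ) (hz0 : z 0 = y)
    (hz : ∀ k, y * z (k + 1) = r * z k) (hC : ∀ k, |z k| ≤ C) : r * r = y * y := by
  have hyQ : (0 : ℚ) < y := by exact_mod_cast hy
  have hrQ : (r : ℚ) ≠ 0 := by exact_mod_cast hr
  set l : ℚ := r / y with hl
  have hl0 : 0 < |l| := abs_pos.2 (div_ne_zero hrQ hyQ.ne')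
  have hzk : ∀ k, (z k : ℚ) = l ^ k * y := by
    intro k
    induction k with
    | zero => simp [hz0]
    | succ k ih =>
      have h1 : (y : ℚ) * z (k + 1) = r * z k := by exact_mod_cast hz k
      rw [ih] at h1
      rw [pow_succ, hl] at *
      field_simp at h1 ⊢
      linarith
  have habs : ∀ k, |(z k : ℚ)| = |l| ^ k * y := by
    intro k
    rw [hzk, abs_mul, abs_pow, abs_of_pos hyQ]
  have hl1 : |l| = 1 := by
    rcases lt_trichotomy |l| 1 with hlt | heq | hgt
    · obtain ⟨k, hk⟩ := exists_pow_lt_of_lt_one (inv_pos.2 hyQ) hlt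
      have h1 : |(z k : ℚ)| < 1 := by
        rw [habs]
        calc |l| ^ k * y < (y : ℚ)⁻¹ * y := by gcongr
          _ = 1 := inv_mul_cancel₀ hyQ.ne'
      have h2 : z k = 0 := Int.abs_lt_one_iff.1 (by exact_mod_cast h1)
      have h3 := habs k
      rw [h2] at h3
      have h4 : 0 < |l| ^ k * (y : ℚ) := by positivity
      simp at h3
      rcases h3 with h3 | h3
      · exact absurd h3.1 (by intro h0; simp [h0] at hl0)
      · exact absurd h3 hy.ne'
    · exact heq
    · obtain ⟨k, hk⟩ := pow_unbounded_of_one_lt (C : ℚ) hgt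
      have h1 : |(z k : ℚ)| ≤ C := by exact_mod_cast hC k
      rw [habs] at h1
      have h2 : (1 : ℚ) ≤ y := by exact_mod_cast hy
      have h3 : |l| ^ k * 1 ≤ |l| ^ k * (y : ℚ) := by gcongr
      linarith
  have h1 : l * l = 1 := by rw [← abs_mul_abs_self, hl1, one_mul]
  rw [hl] at h1
  field_simp at h1
  have h2 : r ^ 2 = y ^ 2 := by exact_mod_cast h1
  rw [← sq, ← sq, h2]

/-- Only the remainder after the last multiple of p, shorter than p, contributes. -/
theorem abs_weight_pre_le {s : ℕ → Letter} {p : ℕ} (hp : 0 < p) (hx : 0 ≤ x) (hy : 0 ≤ y)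
    (h0 : ∀ k : ℕ, weight x y (pre s (k * p)) = 0) (n : ℕ) :
    |weight x y (pre s n)| ≤ (x + y) * p := by
  have h1 : n = n / p * p + n % p := (Nat.div_add_mod' n p).symm
  rw [h1, pre_add, weight_append, h0, zero_add]
  refine (abs_weight_le hx hy _).trans ?_
  rw [length_pre]
  have : ((n % p : ℕ) : ℤ) ≤ p := by exact_mod_cast (Nat.mod_lt n hp).le
  nlinarith

theorem exists_second_a {s : ℕ → Letter} {L : ℕ} (hL : 2 ≤ (pre s L).count false) :
    ∃ n, 0 < n ∧ n < L ∧ s n = false := by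
  induction L with
  | zero => simp at hL
  | succ L ih =>
    by_cases hs : s L = false
    · refine ⟨L, Nat.pos_of_ne_zero ?_, Nat.lt_succ_self L, hs⟩
      rintro rfl
      simp [pre_succ, hs] at hL
    · rw [pre_succ, List.count_append, List.count_singleton, if_neg (by simpa using hs)] at hL
      obtain ⟨n, hn0, hnL, hn⟩ := ih hL
      exact ⟨n, hn0, hnL.trans (Nat.lt_succ_self L), hn⟩

end Weight

/-! ### Nonsingular matrix: abelian periodicity implies periodicity -/

namespace Generates

variable {h : Letter → List Letter} {s : ℕ → Letter}

theorem one_le_count_head (H : Generates h s) : 1 ≤ (h false).count false := by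
  obtain ⟨u, -, hu⟩ := H.head
  simp [hu]

/-- If `a` occurs twice in the generated word, then it occurs twice in `f^2(a)`. -/
theorem two_le_count_iterWord_two (H : Generates h s) {k : ℕ}
    (hk : 2 ≤ (iterWord h k).count false) : 2 ≤ (iterWord h 2).count false := by
  have hA := H.one_le_count_head
  have h2 : (iterWord h 2).count false = (h false).count false * (h false).count false +
      (h false).count true * (h true).count false := by
    rw [iterWord_succ, iterWord_one, count_substWord]
  by_contra hlt
  have hA1 : (h false).count false = 1 := by nlinarith
  have hB : (h false).count true * (h true).count false = 0 := by
    rw [h2, hA1] at hlt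
    omega
  -- The second clause says that no image of a b contributes an a, which keeps the count at one.
  have key : ∀ k, (iterWord h k).count false = 1 ∧
      (iterWord h k).count true * (h true).count false = 0 := by
    intro k
    induction k with
    | zero => simp
    | succ k ih =>
      rw [iterWord_succ, count_substWord, count_substWord, hA1, ih.1, ih.2]
      refine ⟨rfl, ?_⟩
      rw [add_mul, one_mul, hB, mul_right_comm, ih.2]
      simp
  have := (key k).1
  omega

/-- If `f^2` preserves a weight that is bounded on prefixes of the generated word, then
this weight vanishes in front of each occurrence of `a`. -/
theorem weight_eq_zero_of_bounded (H : Generates h s) {x y C : ℤ}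
    (hC : ∀ n, |weight x y (pre s n)| ≤ C)
    (hinv : ∀ w, weight x y (substWord h (substWord h w)) = weight x y w) {n : ℕ}
    (hn : s n = false) : weight x y (pre s n) = 0 := by
  have hinv' : ∀ J w, weight x y ((substWord h)^[2 * J] w) = weight x y w := by
    intro J w
    induction J with
    | zero => rfl
    | succ J ih =>
      rw [show 2 * (J + 1) = 2 * J + 1 + 1 by ring, Function.iterate_succ_apply',
        Function.iterate_succ_apply', hinv, ih]
  refine eq_zero_of_bounded_mul (C := C) fun m => ?_
  -- Given an a at l, apply f^(2J) to the prefix ending there: the image of what precedes has the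
  -- old weight and is followed by a copy of the prefix up to n, so one more weight of that prefix
  -- is added.
  have key : ∀ m : ℕ, ∃ l, s l = false ∧ weight x y (pre s l) = m * weight x y (pre s n) := by
    intro m
    induction m with
    | zero => exact ⟨0, H.apply_zero, by simp⟩
    | succ m ih =>
      obtain ⟨l, hl, hw⟩ := ih
      set J := n + 1
      have h1 : pre s (n + 1) <+: iterWord h (2 * J) :=
        H.pre_prefix_iterWord (le_trans (by omega) (H.lt_length _).le)
      have h2 : pre s (l + 1) = pre s l ++ [false] := by rw [pre_succ, hl]
      have h3 := H.eq_pre_iterate (2 * J) (w := pre s (l + 1)) (by simp)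
      rw [h2, iterate_substWord_append] at h3
      have h4 : (substWord h)^[2 * J] (pre s l) ++ pre s (n + 1) <+:
          (substWord h)^[2 * J] (pre s l) ++ (substWord h)^[2 * J] [false] :=
        (List.prefix_append_right_inj _).2 h1
      rw [h3] at h4
      have h5 := eq_pre_of_prefix h4
      rw [pre_succ, ← List.append_assoc] at h5
      have h6 := eq_pre_concat h5
      refine ⟨_, h6.2.symm.trans hn, ?_⟩
      rw [← h6.1, weight_append, hinv', hw]
      push_cast
      ring
  obtain ⟨l, -, hl⟩ := key m
  rw [← hl]
  exact hC l

/-- Abelian periodicity of a word whose morphism has nonsingular matrix forces periodicity. -/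
theorem exists_period (H : Generates h s) (hper : IsPurelyAbelianPeriodic s)
    (hdet : (h false).count false * (h true).count true ≠
      (h true).count false * (h false).count true) :
    ∃ q, 0 < q ∧ q ≤ (iterWord h 2).length ∧ ∀ n, s (n + q) = s n := by
  obtain ⟨p, hp⟩ := hper
  obtain ⟨hp0, hp⟩ := (isAbelianPeriodicWith_zero_iff s p).1 hp
  obtain ⟨X, hX⟩ : ∃ X, X = (pre s p).count false := ⟨_, rfl⟩
  obtain ⟨Y, hY⟩ : ∃ Y, Y = (pre s p).count true := ⟨_, rfl⟩
  have hX0 : 0 < X := by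
    rw [hX, List.count_pos_iff]
    exact List.mem_map.2 ⟨0, by simpa using hp0, H.apply_zero⟩
  rcases Nat.eq_zero_or_pos Y with hY0 | hY0
  · have hs : ∀ n, s n = false := by
      intro n
      have h1 := hp (n + 1) true
      rw [← hY, hY0, Nat.mul_zero, List.count_eq_zero] at h1
      by_contra hn
      refine h1 (List.mem_map.2 ⟨n, ?_, by simpa using hn⟩)
      rw [List.mem_range]
      nlinarith
    exact ⟨1, one_pos, Nat.one_le_of_lt (H.lt_length 2), fun n => by rw [hs, hs]⟩
  set W := weight (X : ℤ) (Y : ℤ) with hW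
  have hWk : ∀ k : ℕ, W (pre s (k * p)) = 0 := by
    intro k
    rw [hW, weight, hp, hp, ← hX, ← hY]
    push_cast
    ring
  have hC := abs_weight_pre_le hp0 (Int.natCast_nonneg X) (Int.natCast_nonneg Y) hWk
  have hXZ : (0 : ℤ) < X := by exact_mod_cast hX0
  have hYZ : (0 : ℤ) < Y := by exact_mod_cast hY0
  -- The image of the prefix of length kp is again a prefix, and its weight is k times this number.
  have he : (X : ℤ) * W (h false) + Y * W (h true) = 0 := by
    refine eq_zero_of_bounded_mul (C := ((X : ℤ) + Y) * p) fun k => ?_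
    have h1 := H.eq_pre_substWord (w := pre s (k * p)) (by simp)
    have h2 : (k : ℤ) * (X * W (h false) + Y * W (h true)) = W (substWord h (pre s (k * p))) := by
      rw [hW, weight_substWord, hp, hp, ← hX, ← hY]
      push_cast
      ring
    rw [h2, h1]
    exact hC _
  set r := W (h false) with hr
  -- W is a left eigenvector with eigenvalue r/Y; denominators are cleared.
  have hlin : ∀ w, (Y : ℤ) * W (substWord h w) = r * W w := by
    intro w
    have h1 : (Y : ℤ) * W (h true) = -(X * r) := by linarith
    have h2 : W (substWord h w) = w.count false * r + w.count true * W (h true) :=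
      weight_substWord h w
    have h3 : W w = Y * w.count false - X * w.count true := rfl
    rw [h2, h3]
    linear_combination (w.count true : ℤ) * h1
  -- If r = 0, both images have count vectors on the line through (X, Y), against nonsingularity.
  have hr0 : r ≠ 0 := by
    intro h0
    have h1 : (Y : ℤ) * (h false).count false - X * (h false).count true = 0 := h0
    have h2 : (Y : ℤ) * (h true).count false - X * (h true).count true = 0 := by
      have h3 : (Y : ℤ) * W (h true) = 0 := by rw [h0] at he; linarith
      exact (mul_eq_zero.1 h3).resolve_left hYZ.ne'
    apply hdet
    have h4 : (X : ℤ) * ((h false).count false * (h true).count true) =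
        X * ((h true).count false * (h false).count true) := by
      linear_combination ((h true).count false : ℤ) * h1 - ((h false).count false : ℤ) * h2
    exact_mod_cast mul_left_cancel₀ hXZ.ne' h4
  have hsq : r * r = (Y : ℤ) * Y := by
    refine sq_eq_sq_of_bounded hr0 hYZ (fun k => W (iterWord h k)) (by simp [hW])
      (fun k => ?_) (C := ((X : ℤ) + Y) * p) fun k => ?_
    · simp only [iterWord_succ, hlin]
    · rw [H.isPre k]
      exact hC _
  have hinv : ∀ w, W (substWord h (substWord h w)) = W w := by
    intro w
    have h1 := hlin (substWord h w)
    have h2 := hlin w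
    have h3 : (Y : ℤ) * Y * W (substWord h (substWord h w)) = Y * Y * W w := by
      linear_combination (Y : ℤ) * h1 + r * h2 + W w * hsq
    exact mul_left_cancel₀ (mul_pos hYZ hYZ).ne' h3
  have hfalse : ∀ n, s n = false → W (pre s n) = 0 := fun n hn =>
    H.weight_eq_zero_of_bounded hC hinv hn
  have hsucc : ∀ n, W (pre s (n + 1)) = W (pre s n) + W [s n] := fun n => by
    rw [pre_succ, hW, weight_append]
  -- From a negative weight no a can follow, so the weight would drop by X forever.
  have hneg : ∀ n, ¬ W (pre s n) < 0 := by
    intro n hn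
    have h1 : ∀ m : ℕ, W (pre s (n + m)) = W (pre s n) - m * X := by
      intro m
      induction m with
      | zero => simp
      | succ m ih =>
        have h2 : s (n + m) = true := by
          by_contra h3
          have h4 := hfalse (n + m) (by simpa using h3)
          rw [ih] at h4
          nlinarith
        rw [← Nat.add_assoc, hsucc, ih, h2, hW, weight_b]
        push_cast
        ring
    have h2 : (X : ℤ) = 0 := by
      refine eq_zero_of_bounded_mul (C := ((X : ℤ) + Y) * p + |W (pre s n)|) fun m => ?_
      have h3 : (m : ℤ) * X = W (pre s n) - W (pre s (n + m)) := by rw [h1]; ring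
      rw [h3]
      have := abs_sub (W (pre s n)) (W (pre s (n + m)))
      have := hC (n + m)
      linarith
    exact hXZ.ne' h2
  have hiff : ∀ n, s n = false ↔ W (pre s n) = 0 := by
    refine fun n => ⟨hfalse n, fun hn => ?_⟩
    by_contra h1
    have h2 : s n = true := by simpa using h1
    apply hneg (n + 1)
    rw [hsucc, hn, h2, hW, weight_b]
    linarith
  have h2a : 2 ≤ (iterWord h 2).count false := by
    -- The prefix of length 2p contains 2X ≥ 2 letters a.
    refine H.two_le_count_iterWord_two (k := 2 * p) ?_
    have h1 := (H.pre_prefix_iterWord (H.lt_length (2 * p)).le).sublist.count_le false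
    rw [hp, ← hX] at h1
    omega
  rw [H.isPre 2] at h2a
  obtain ⟨q, hq0, hqL, hq⟩ := exists_second_a h2a
  refine ⟨q, hq0, hqL.le, ?_⟩
  -- The weight is back at zero at q, and from there equal weights give equal letters.
  have hper : ∀ n, W (pre s (n + q)) = W (pre s n) := by
    intro n
    induction n with
    | zero => rw [Nat.zero_add, (hiff q).1 hq]; simp [hW]
    | succ n ih =>
      have h1 : s (n + q) = s n := by
        rw [Bool.eq_iff_iff, ← not_iff_not]
        simp [hiff, ih]
      rw [Nat.add_right_comm, hsucc, hsucc, ih, h1]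
  intro n
  rw [Bool.eq_iff_iff, ← not_iff_not]
  simp [hiff, hper]

end Generates

/-! ### Singular matrix: testing a given period -/

/-- The weight that vanishes on the letter counts of the image of `a`. -/
def disc (h : Letter → List Letter) (w : List Letter) : ℤ :=
  weight ((h false).count false) ((h false).count true) w

/-- The matrix of the morphism with letter images `h` is singular. -/
def IsSingular (h : Letter → List Letter) : Prop :=
  (h false).count false * (h true).count true = (h true).count false * (h false).count true

section Singular

variable {h : Letter → List Letter}

@[simp] theorem disc_append (u v : List Letter) : disc h (u ++ v) = disc h u + disc h v :=
  weight_append u v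

theorem IsSingular.disc_substWord (hdet : IsSingular h) (w : List Letter) :
    disc h (substWord h w) = 0 := by
  rw [disc, weight_substWord, weight, weight]
  have h1 : ((h false).count false : ℤ) * (h true).count true =
      (h true).count false * (h false).count true := by exact_mod_cast hdet
  linear_combination -(w.count true : ℤ) * h1

/-- The growth factor of the lengths of images, for a morphism with singular matrix. -/
def growth (h : Letter → List Letter) : ℕ := (h false).count false + (h true).count true

/-- On the line spanned by the counts of f(a) the matrix acts as multiplication by its trace. -/
theorem IsSingular.length_substWord_substWord (hdet : IsSingular h) (w : List Letter) :
    (substWord h (substWord h w)).length = growth h * (substWord h w).length := by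
  have h1 : ((h false).count false : ℤ) * (h true).count true =
      (h true).count false * (h false).count true := by exact_mod_cast hdet
  rw [length_substWord, length_substWord, count_substWord, count_substWord, growth,
    length_eq_count (h false), length_eq_count (h true)]
  zify
  linear_combination (-(w.count false : ℤ) - w.count true) * h1

end Singular

namespace Generates

variable {h : Letter → List Letter} {s : ℕ → Letter}

/-- A zero of `disc` fixes the ratio of the counts; together with the length kp it fixes both
counts, linearly in k. -/
theorem isPurelyAbelianPeriodic_of_disc (H : Generates h s) {p : ℕ} (hp : 0 < p)
    (hd : ∀ k, disc h (pre s (k * p)) = 0) : IsPurelyAbelianPeriodic s := by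
  refine ⟨p, (isAbelianPeriodicWith_zero_iff s p).2 ⟨hp, ?_⟩⟩
  obtain ⟨A, hA⟩ : ∃ A, A = (h false).count false := ⟨_, rfl⟩
  obtain ⟨B, hB⟩ : ∃ B, B = (h false).count true := ⟨_, rfl⟩
  have hA1 : 0 < A := hA ▸ H.one_le_count_head
  have key : ∀ k, (A + B) * (pre s (k * p)).count false = A * (k * p) := by
    intro k
    have h1 : (B : ℤ) * (pre s (k * p)).count false - A * (pre s (k * p)).count true = 0 := by
      have := hd k
      rwa [disc, weight, ← hA, ← hB] at this
    have h2 := length_eq_count (pre s (k * p))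
    rw [length_pre] at h2
    zify at h2 ⊢
    linear_combination h1 - (A : ℤ) * h2
  have hfalse : ∀ k, (pre s (k * p)).count false = k * (pre s p).count false := by
    intro k
    have h1 := key k
    have h2 := key 1
    rw [one_mul] at h2
    refine Nat.eq_of_mul_eq_mul_left (Nat.add_pos_left hA1 B) ?_
    rw [h1, mul_left_comm (A + B) k, h2]
    ring
  intro k c
  cases c
  · exact hfalse k
  · have h1 := length_eq_count (pre s (k * p))
    have h2 := length_eq_count (pre s p)
    rw [length_pre] at h1 h2
    rw [hfalse] at h1
    have h3 : k * p = k * (pre s p).count false + k * (pre s p).count true := by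
      rw [← mul_add, ← h2]
    omega

/-- For a singular matrix, abelian periodicity with a given period can be read off from
a finite prefix. -/
theorem disc_eq_zero_of_forall_le (H : Generates h s) (hdet : IsSingular h) {p : ℕ} (hp : 0 < p)
    (hcheck : ∀ n ≤ (iterWord h (2 * p + 1)).length, p ∣ n →
      disc h ((iterWord h (2 * p + 1)).take n) = 0) (k : ℕ) :
    disc h (pre s (k * p)) = 0 := by
  have : NeZero p := ⟨hp.ne'⟩
  -- A state is a letter occurrence together with the length, mod p, of the image of what precedes
  -- it. Lengths of images scale by `growth` under f, so states in f^t(a) determine those in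
  -- f^(t+1)(a).
  let S : ℕ → Set (Bool × ZMod p) := fun t =>
    {q | ∃ u, u ++ [q.1] <+: iterWord h t ∧ ((substWord h u).length : ZMod p) = q.2}
  have hmono : Monotone S := by
    intro t t' htt q hq
    obtain ⟨u, hu, hq⟩ := hq
    exact ⟨u, hu.trans (H.iterWord_prefix htt), hq⟩
  have hstep : ∀ t t', S t ⊆ S t' → S (t + 1) ⊆ S (t' + 1) := by
    rintro t t' htt ⟨y, ρ⟩ ⟨v, hv, hρ⟩
    simp only at hv hρ
    have hlt : v.length < (substWord h (iterWord h t)).length := by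
      have := hv.length_le
      rw [iterWord_succ] at this
      simp at this
      omega
    obtain ⟨u, x, i, hu, hi, hvi, htake⟩ := exists_prefix_substWord hlt
    obtain ⟨u', hu', hρ'⟩ := htt (show (x, ((substWord h u).length : ZMod p)) ∈ S t from ⟨u, hu, rfl⟩)
    simp only at hu' hρ'
    have hpx : substWord h u ++ h x <+: iterWord h (t + 1) := by
      have := substWord_prefix (h := h) hu
      simpa [iterWord_succ] using this
    have hveq : v = substWord h u ++ (h x).take i := by
      rw [← htake, ← iterWord_succ]
      exact List.prefix_iff_eq_take.1 ((List.prefix_append _ _).trans hv)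
    have hvx : (h x).take i ++ [y] <+: h x := by
      have h1 : v ++ [y] <+: substWord h u ++ h x := by
        refine List.prefix_of_prefix_length_le hv hpx ?_
        simp [hvi]
        omega
      rw [hveq, List.append_assoc] at h1
      exact (List.prefix_append_right_inj _).1 h1
    refine ⟨substWord h u' ++ (h x).take i, ?_, ?_⟩
    · have h2 := substWord_prefix (h := h) hu'
      rw [substWord_append, ← iterWord_succ] at h2
      refine List.IsPrefix.trans ?_ h2
      rw [List.append_assoc]
      refine (List.prefix_append_right_inj _).2 ?_
      simpa using hvx
    · rw [← hρ, hveq]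
      simp only [substWord_append, List.length_append, hdet.length_substWord_substWord]
      push_cast
      rw [hρ']
  -- There are 2p states, and an increasing chain in which each set determines the next is constant
  -- once it repeats.
  have hS : ∀ t, S t ⊆ S (2 * p) := by
    have hcard : ∀ t, (S t).ncard ≤ 2 * p := by
      intro t
      have h1 := Set.ncard_le_ncard (Set.subset_univ (S t))
      rw [Set.ncard_univ, Nat.card_prod, Nat.card_zmod, Nat.card_eq_fintype_card,
        Fintype.card_bool] at h1
      exact h1
    intro t
    rcases le_total t (2 * p) with htp | htp
    · exact hmono htp
    · have hst : (S t).ncard = (S (2 * p)).ncard := by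
        refine Nat.stabilises_of_monotone (f := fun t => (S t).ncard)
          (fun a b hab => Set.ncard_le_ncard (hmono hab)) hcard ?_ htp
        intro m hm
        have h1 : S m = S (m + 1) :=
          Set.eq_of_subset_of_ncard_le (hmono (Nat.le_succ m)) hm.ge
        rw [Set.Subset.antisymm (hstep m (m + 1) h1.subset) (hstep (m + 1) m h1.symm.subset)]
      exact (Set.eq_of_subset_of_ncard_le (hmono htp) hst.le).symm.subset
  obtain ⟨u, x, i, hu, hi, hn, hpre⟩ := H.exists_position (k * p)
  have hmem : (x, ((substWord h u).length : ZMod p)) ∈ S ((u ++ [x]).length) := by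
    refine ⟨u, ?_, rfl⟩
    rw [hu, length_pre]
    exact H.pre_prefix_iterWord (H.lt_length _).le
  -- Replace the occurrence by one in f^(2p)(a) with the same state: at the same offset in its
  -- image, inside f^(2p+1)(a), lies a multiple of p with the same weight.
  obtain ⟨u', hu', hρ'⟩ := hS _ hmem
  simp only at hu' hρ'
  have h1 := substWord_prefix (h := h) hu'
  rw [← iterWord_succ, substWord_append] at h1
  have h2 : substWord h u' ++ (h x).take i <+: iterWord h (2 * p + 1) := by
    refine List.IsPrefix.trans ((List.prefix_append_right_inj _).2 ?_) h1
    simpa using List.take_prefix i (h x)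
  have h3 := hcheck _ h2.length_le (by
    rw [← ZMod.natCast_eq_zero_iff, List.length_append, List.length_take, min_eq_left hi.le]
    push_cast
    rw [hρ', ← Nat.cast_add, ← hn]
    simp)
  rw [← List.prefix_iff_eq_take.1 h2] at h3
  rw [hpre, disc_append, hdet.disc_substWord]
  rwa [disc_append, hdet.disc_substWord] at h3

end Generates

/-! ### Singular matrix: bounding the period -/

/-- A position inside the image of a letter of the generated word. -/
abbrev LocalPosition (h : Letter → List Letter) : Type := Σ x : Letter, Fin (h x).length

/-- Position `n` lies at offset `q.2` inside the image of an occurrence of the letter `q.1`. -/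
def HasLocalPosition (h : Letter → List Letter) (s : ℕ → Letter) (n : ℕ) (q : LocalPosition h) :
    Prop :=
  ∃ u, u ++ [q.1] = pre s (u ++ [q.1]).length ∧ n = (substWord h u).length + q.2

theorem IsSingular.length_iterate_substWord {h : Letter → List Letter} (hdet : IsSingular h)
    (J : ℕ) (w : List Letter) :
    ((substWord h)^[J + 1] w).length = growth h ^ J * (substWord h w).length := by
  induction J with
  | zero => simp
  | succ J ih =>
    rw [Function.iterate_succ_apply', Function.iterate_succ_apply',
      hdet.length_substWord_substWord, ← Function.iterate_succ_apply' (substWord h) J w, ih]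
    ring

/-- In the orbit of a point under a self-map of a finite type, the points after the first
`card` many recur. -/
theorem exists_iterate_card_eq {α : Type*} [Fintype α] (G : α → α) (q : α) (J : ℕ) :
    ∃ I, J ≤ I ∧ G^[I] q = G^[Fintype.card α] q := by
  obtain ⟨i, j, hij, heq⟩ := Fintype.exists_ne_map_eq_of_card_lt
    (fun i : Fin (Fintype.card α + 1) => G^[i] q) (by simp)
  wlog hlt : i < j generalizing i j
  · exact this j i hij.symm heq.symm (lt_of_le_of_ne (not_lt.1 hlt) hij.symm)
  obtain ⟨d, hd⟩ := Nat.exists_eq_add_of_lt (Fin.lt_def.1 hlt)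
  obtain ⟨e, he⟩ := Nat.exists_eq_add_of_le (Nat.le_of_lt_succ i.2)
  have hper : ∀ t, G^[t * (d + 1) + i] q = G^[i] q := by
    intro t
    induction t with
    | zero => simp
    | succ t ih =>
      have h1 : (t + 1) * (d + 1) + (i : ℕ) = t * (d + 1) + j := by rw [hd]; ring
      rw [h1, Function.iterate_add_apply, ← heq, ← Function.iterate_add_apply, ih]
  -- Adding J cycles of length d + 1 pushes the exponent beyond J.
  refine ⟨J * (d + 1) + Fintype.card α, by nlinarith, ?_⟩
  have h1 : J * (d + 1) + Fintype.card α = e + (J * (d + 1) + i) := by omega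
  rw [h1, Function.iterate_add_apply, hper, ← Function.iterate_add_apply, Nat.add_comm e, ← he]

namespace Generates

variable {h : Letter → List Letter} {s : ℕ → Letter}

theorem abs_disc_pre_le (H : Generates h s) (hdet : IsSingular h) :
    ∃ C, ∀ n, |disc h (pre s n)| ≤ C := by
  refine ⟨((h false).count false + (h false).count true) *
    ((h false).length + (h true).length), fun n => ?_⟩
  obtain ⟨u, x, i, -, hi, -, hpre⟩ := H.exists_position n
  rw [hpre, disc_append, hdet.disc_substWord, zero_add]
  refine (abs_weight_le (by positivity) (by positivity) _).trans ?_
  gcongr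
  rw [List.length_take]
  cases x <;> push_cast <;> omega

/-- For a singular matrix, the weight vanishes at all multiples of an abelian period. -/
theorem disc_eq_zero_of_isAbelianPeriodicWith (H : Generates h s) (hdet : IsSingular h) {p : ℕ}
    (hp : IsAbelianPeriodicWith s p 0) (k : ℕ) : disc h (pre s (k * p)) = 0 := by
  obtain ⟨-, hp⟩ := (isAbelianPeriodicWith_zero_iff s p).1 hp
  obtain ⟨C, hC⟩ := H.abs_disc_pre_le hdet
  have hk : ∀ k : ℕ, disc h (pre s (k * p)) = k * disc h (pre s p) := by
    intro k
    rw [disc, disc, weight, weight, hp, hp]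
    push_cast
    ring
  rw [hk, eq_zero_of_bounded_mul (e := disc h (pre s p)) (C := C) fun k => hk k ▸ hC _, mul_zero]

/-- Moving by the image of a prefix that is followed by `a` does not change the weight. -/
theorem disc_shift (H : Generates h s) (hdet : IsSingular h) {w : List Letter}
    (hw : w ++ [false] = pre s (w ++ [false]).length) {J n : ℕ}
    (hn : n ≤ (iterWord h (J + 1)).length) :
    disc h (pre s (((substWord h)^[J + 1] w).length + n)) = disc h (pre s n) := by
  have h1 := H.eq_pre_iterate (J + 1) hw
  rw [iterate_substWord_append] at h1
  have h2 : (substWord h)^[J + 1] w ++ pre s n <+: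
      (substWord h)^[J + 1] w ++ (substWord h)^[J + 1] [false] :=
    (List.prefix_append_right_inj _).2 (H.pre_prefix_iterWord hn)
  rw [h1] at h2
  have h3 := eq_pre_of_prefix h2
  rw [List.length_append, length_pre] at h3
  rw [← h3, disc_append, Function.iterate_succ_apply', hdet.disc_substWord, zero_add]

/-- If there is an abelian period, then for some `J` the length of the image under `f^(J+1)` of
a prefix `w` followed by `a` is an abelian period, too. -/
theorem exists_disc_eq_zero (H : Generates h s) (hdet : IsSingular h) {w : List Letter}
    (hw : w ++ [false] = pre s (w ++ [false]).length) {p : ℕ} (hp : 0 < p)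
    (hd : ∀ k, disc h (pre s (k * p)) = 0) :
    ∃ J, ∀ k, disc h (pre s (k * ((substWord h)^[J + 1] w).length)) = 0 := by
  have : NeZero p := ⟨hp.ne'⟩
  -- Infinitely many exponents share a residue; each shift below needs one large enough for
  -- `disc_shift` at the current position.
  obtain ⟨ρ, hρ⟩ := Finite.exists_infinite_fiber
    fun J : ℕ => ((((substWord h)^[J + 1] w).length : ℕ) : ZMod p)
  rw [Set.infinite_coe_iff] at hρ
  obtain ⟨J, hJ⟩ := hρ.nonempty
  refine ⟨J, fun k => ?_⟩
  set n := k * ((substWord h)^[J + 1] w).length with hn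
  have key : ∀ m : ℕ, ∃ N, disc h (pre s N) = disc h (pre s n) ∧ (N : ZMod p) = n + m * ρ := by
    intro m
    induction m with
    | zero => exact ⟨n, rfl, by simp⟩
    | succ m ih =>
      obtain ⟨N, hN, hNρ⟩ := ih
      obtain ⟨I, hI, hIN⟩ := hρ.exists_gt N
      have hI' : ((((substWord h)^[I + 1] w).length : ℕ) : ZMod p) = ρ := hI
      refine ⟨((substWord h)^[I + 1] w).length + N, ?_, ?_⟩
      · rw [H.disc_shift hdet hw, hN]
        exact le_trans (by omega) (H.lt_length (I + 1)).le
      · push_cast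
        rw [hI', hNρ]
        ring
  -- Starting from n ≡ kρ, these shifts reach kpρ ≡ 0 mod p without changing the weight.
  obtain ⟨N, hN, hNρ⟩ := key (k * (p - 1))
  have hJ' : ((((substWord h)^[J + 1] w).length : ℕ) : ZMod p) = ρ := hJ
  have h0 : (N : ZMod p) = 0 := by
    rw [hNρ, hn]
    push_cast
    rw [hJ', Nat.cast_sub hp]
    simp
  obtain ⟨m, rfl⟩ := (ZMod.natCast_eq_zero_iff _ _).1 h0
  rw [← hN, Nat.mul_comm, hd]

theorem exists_hasLocalPosition (H : Generates h s) (n : ℕ) : ∃ q, HasLocalPosition h s n q := by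
  obtain ⟨u, x, i, hu, hi, hn, -⟩ := H.exists_position n
  exact ⟨⟨x, i, hi⟩, u, hu, hn⟩

theorem disc_of_hasLocalPosition (H : Generates h s) (hdet : IsSingular h) {n : ℕ}
    {q : LocalPosition h} (hq : HasLocalPosition h s n q) :
    disc h (pre s n) = disc h ((h q.1).take q.2) := by
  obtain ⟨u, hu, rfl⟩ := hq
  have h1 := H.eq_pre_substWord hu
  have h2 : substWord h u ++ (h q.1).take q.2 <+: substWord h (u ++ [q.1]) := by
    rw [substWord_append, List.prefix_append_right_inj]
    simpa using List.take_prefix _ _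
  rw [h1] at h2
  have h3 := eq_pre_of_prefix h2
  rw [List.length_append, List.length_take, min_eq_left q.2.2.le] at h3
  rw [← h3, disc_append, hdet.disc_substWord, zero_add]

/-- Local positions determine each other under multiplication of positions by the growth
factor. -/
theorem exists_map_localPosition (H : Generates h s) (hdet : IsSingular h) :
    ∃ G : LocalPosition h → LocalPosition h, ∀ n q, HasLocalPosition h s n q →
      HasLocalPosition h s (growth h * n) (G q) := by
  have key : ∀ q : LocalPosition h, ∃ q' : LocalPosition h, ∀ n, HasLocalPosition h s n q →
      HasLocalPosition h s (growth h * n) q' := by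
    rintro ⟨x, i⟩
    have hθ : 0 < growth h := Nat.add_pos_left H.one_le_count_head _
    have hx : (substWord h (h x)).length = growth h * (h x).length := by
      have := hdet.length_substWord_substWord [x]
      simpa using this
    -- As f²(x) is `growth` times as long as f(x), the scaled offset falls in the image of a letter
    -- of f(x), independently of where x occurs.
    have hlt : growth h * i < (substWord h (h x)).length := by
      rw [hx]
      exact Nat.mul_lt_mul_of_pos_left i.2 hθ
    obtain ⟨v, y, j, hv, hj, hij, -⟩ := exists_prefix_substWord hlt
    refine ⟨⟨y, j, hj⟩, ?_⟩
    rintro n ⟨u, hu, rfl⟩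
    refine ⟨substWord h u ++ v, ?_, ?_⟩
    · have h1 := H.eq_pre_substWord hu
      have h2 : (substWord h u ++ v) ++ [y] <+: substWord h (u ++ [x]) := by
        rw [substWord_append, List.append_assoc, List.prefix_append_right_inj]
        simpa using hv
      rw [h1] at h2
      exact eq_pre_of_prefix h2
    · simp only [substWord_append, List.length_append, hdet.length_substWord_substWord]
      rw [mul_add, hij, Nat.add_assoc]
  choose G hG using key
  exact ⟨G, fun n q => hG q n⟩

/-- The exponent in `exists_disc_eq_zero` can be bounded in terms of the morphism. -/
theorem disc_eq_zero_bounded (H : Generates h s) (hdet : IsSingular h) {w : List Letter} {J : ℕ}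
    (hJ : ∀ k, disc h (pre s (k * ((substWord h)^[J + 1] w).length)) = 0) (k : ℕ) :
    disc h (pre s (k * ((substWord h)^[(h false).length + (h true).length + 1] w).length)) = 0 := by
  obtain ⟨G, hG⟩ := H.exists_map_localPosition hdet
  obtain ⟨q, hq⟩ := H.exists_hasLocalPosition (k * (substWord h w).length)
  have hit : ∀ I, HasLocalPosition h s (growth h ^ I * (k * (substWord h w).length)) (G^[I] q) := by
    intro I
    induction I with
    | zero => simpa using hq
    | succ I ih =>
      rw [Function.iterate_succ_apply', pow_succ', mul_assoc]
      exact hG _ _ ih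
  have hcard : Fintype.card (LocalPosition h) = (h false).length + (h true).length := by
    simp [Nat.add_comm]
  -- The position with exponent I ≥ J is a multiple of the period known from J, and it has the same
  -- local position, hence weight, as the one with the bounded exponent.
  obtain ⟨I, hJI, hI⟩ := exists_iterate_card_eq G q J
  obtain ⟨d, rfl⟩ := Nat.exists_eq_add_of_le hJI
  rw [hcard] at hI
  have h1 := H.disc_of_hasLocalPosition hdet (hit (J + d))
  rw [hI, ← H.disc_of_hasLocalPosition hdet (hit _)] at h1
  rw [hdet.length_iterate_substWord, mul_left_comm, ← h1, pow_add]
  have h2 := hJ (growth h ^ d * k)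
  rw [hdet.length_iterate_substWord] at h2
  convert h2 using 3
  ring

/-- For a singular matrix, there is an abelian period below a bound that depends only on the
morphism, as soon as there is any. -/
theorem exists_disc_eq_zero_le (H : Generates h s) (hdet : IsSingular h)
    (hB : 0 < (h false).count true) (hper : IsPurelyAbelianPeriodic s) :
    ∃ p, 0 < p ∧ p ≤ (iterWord h ((h false).length + (h true).length + 3)).length ∧
      ∀ k, disc h (pre s (k * p)) = 0 := by
  obtain ⟨p, hp⟩ := hper
  have hA := H.one_le_count_head
  -- Otherwise singularity would make f(b) empty. Consequently a occurs twice in f²(a).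
  have hA' : 0 < (h true).count false := by
    by_contra h0
    have h1 : (h true).count false = 0 := by omega
    have h2 := H.length_image_pos true
    have h3 : (h false).count false * (h true).count true =
      (h true).count false * (h false).count true := hdet
    rw [length_eq_count, h1] at h2
    rw [h1, Nat.zero_mul, Nat.mul_eq_zero] at h3
    omega
  have h2a : 2 ≤ (iterWord h 2).count false := by
    rw [iterWord_succ, iterWord_one, count_substWord]
    nlinarith
  rw [H.isPre 2] at h2a
  obtain ⟨n, hn0, hnL, hn⟩ := exists_second_a h2a
  have hw : pre s n ++ [false] = pre s (pre s n ++ [false]).length := by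
    simp [pre_succ, hn]
  obtain ⟨J, hJ⟩ := H.exists_disc_eq_zero hdet hw hp.1
    (H.disc_eq_zero_of_isAbelianPeriodicWith hdet hp)
  refine ⟨_, ?_, ?_, H.disc_eq_zero_bounded hdet hJ⟩
  · rw [hdet.length_iterate_substWord]
    refine Nat.mul_pos (pow_pos (Nat.add_pos_left hA _) _) ?_
    exact lt_of_lt_of_le (by simpa using hn0) (H.length_le_substWord _)
  · rw [show (h false).length + (h true).length + 3 = (h false).length + (h true).length + 1 + 2
      by ring, iterWord_add]
    exact (iterate_substWord_prefix _ (H.pre_prefix_iterWord hnL.le)).length_le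

end Generates

/-! ### The decision criterion and its correctness -/

/-- The letter images of the morphism given by a pair of words. -/
def images (B : List Letter × List Letter) (c : Letter) : List Letter := bif c then B.2 else B.1

/-- The criterion for the generated word to be periodic. -/
def PeriodicCriterion (B : List Letter × List Letter) : Prop :=
  ∃ q ≤ (iterWord (images B) 2).length, 0 < q ∧
    listPow (substWord (images B) ((iterWord (images B) 2).take q)) q =
      listPow ((iterWord (images B) 2).take q)
        (substWord (images B) ((iterWord (images B) 2).take q)).length

/-- The criterion for the generated word to be abelian periodic, for a singular matrix. -/
def SingularCriterion (B : List Letter × List Letter) : Prop :=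
  B.1.count false * B.2.count true = B.2.count false * B.1.count true ∧
  ∃ p ≤ (iterWord (images B) (B.1.length + B.2.length + 3)).length, 0 < p ∧
    ∀ n ≤ (iterWord (images B) (2 * p + 1)).length, n % p = 0 →
      B.1.count true * ((iterWord (images B) (2 * p + 1)).take n).count false =
        B.1.count false * ((iterWord (images B) (2 * p + 1)).take n).count true

section Correctness

theorem Generates.isPurelyAbelianPeriodic_iff {B : List Letter × List Letter} {s : ℕ → Letter}
    (H : Generates (images B) s) :
    IsPurelyAbelianPeriodic s ↔ PeriodicCriterion B ∨ SingularCriterion B := by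
  have hdisc : ∀ w, disc (images B) w = 0 ↔
      B.1.count true * w.count false = B.1.count false * w.count true := by
    intro w
    rw [disc, weight, sub_eq_zero]
    exact_mod_cast Iff.rfl
  have hperiodic : (∃ q, 0 < q ∧ q ≤ (iterWord (images B) 2).length ∧ ∀ n, s (n + q) = s n) →
      PeriodicCriterion B := by
    rintro ⟨q, hq0, hqL, hq⟩
    refine ⟨q, hqL, hq0, ?_⟩
    rw [H.take_iterWord hqL]
    exact H.listPow_eq_of_periodic hq
  constructor
  · intro hper
    by_cases hdet : IsSingular (images B)
    -- If f(a) has no b, the word is constant and falls under the periodic criterion; the bound on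
    -- abelian periods assumes a b in f(a).
    · rcases Nat.eq_zero_or_pos ((images B false).count true) with hB | hB
      · refine Or.inl (hperiodic ⟨1, one_pos, Nat.one_le_of_lt (H.lt_length 2), ?_⟩)
        have key : ∀ k, (iterWord (images B) k).count true = 0 := by
          intro k
          induction k with
          | zero => simp
          | succ k ih => rw [iterWord_succ, count_substWord, hB, ih, mul_zero, zero_mul, add_zero]
        have hs : ∀ n, s n = false := by
          intro n
          by_contra hn
          have h1 : true ∈ pre s (n + 1) := by
            rw [pre_succ, show s n = true by simpa using hn]
            simp
          have h2 := (H.pre_prefix_iterWord (H.lt_length (n + 1)).le).subset h1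
          exact List.count_eq_zero.1 (key (n + 1)) h2
        intro n
        rw [hs, hs]
      · obtain ⟨p, hp0, hpL, hp⟩ := H.exists_disc_eq_zero_le hdet hB hper
        refine Or.inr ⟨hdet, p, hpL, hp0, fun n hn hpn => ?_⟩
        obtain ⟨k, rfl⟩ := Nat.dvd_of_mod_eq_zero hpn
        rw [← hdisc, H.take_iterWord hn, Nat.mul_comm]
        exact hp k
    · exact Or.inl (hperiodic (H.exists_period hper hdet))
  · rintro (⟨q, hqL, hq0, hq⟩ | ⟨hdet, p, -, hp0, hp⟩)
    · rw [H.take_iterWord hqL] at hq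
      exact isPurelyAbelianPeriodic_of_periodic hq0 (H.periodic_of_listPow_eq hq0 hq)
    · refine H.isPurelyAbelianPeriodic_of_disc hp0 (H.disc_eq_zero_of_forall_le hdet hp0 ?_)
      exact fun n hn hpn => (hdisc _).2 (hp n hn (Nat.mod_eq_zero_of_dvd hpn))

theorem toList_map_eq_substWord (f : Morphism) (w : Word) :
    (f w).toList = substWord (images (blocks f)) w.toList := by
  induction w using FreeMonoid.inductionOn' with
  | one => simp
  | of_mul c w ih =>
    rw [map_mul, FreeMonoid.toList_mul, ih, FreeMonoid.toList_mul, FreeMonoid.toList_of,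
      substWord_append]
    cases c <;> simp [images, blocks, substWord]

theorem toList_iterate_eq_iterWord (f : Morphism) (k : ℕ) :
    (f^[k] (FreeMonoid.of Letter.a)).toList = iterWord (images (blocks f)) k := by
  induction k with
  | zero => rfl
  | succ k ih => rw [Function.iterate_succ_apply', toList_map_eq_substWord, ih, iterWord_succ]

theorem eq_pre_of_isPrefixOfInfinite {w : Word} {s : ℕ → Letter} (hw : IsPrefixOfInfinite w s) :
    w.toList = pre s w.toList.length := by
  refine List.ext_getElem? fun i => ?_
  by_cases hi : i < w.toList.length
  · rw [hw i hi]
    simp [pre, hi]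
  · rw [List.getElem?_eq_none (by omega), List.getElem?_eq_none (by simp; omega)]

theorem generates_omegaWord {f : Morphism} (hf : IsProlongable f) :
    Generates (images (blocks f)) (omegaWord f) where
  head := by
    obtain ⟨-, u, hu, hfu⟩ := hf
    refine ⟨u.toList, hu, ?_⟩
    change (f (FreeMonoid.of Letter.a)).toList = _
    rw [hfu]
    rfl
  nonerasing := hf.1 Letter.b
  isPre k := by
    rw [← toList_iterate_eq_iterWord]
    exact eq_pre_of_isPrefixOfInfinite (omegaWord_prefix hf k)

end Correctness

/-! ### Primitive recursiveness of the criteria -/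

section Computability

open Primrec

variable {α : Type*} [Primcodable α]

theorem PrimrecRel.exists_le_bound {R : ℕ → α → Prop} {b : α → ℕ} (hR : PrimrecRel R)
    (hb : Primrec b) : PrimrecPred fun a => ∃ n ≤ b a, R n a :=
  (hR.exists_mem_list.comp (list_range.comp (succ.comp hb)) Primrec.id).of_eq
    fun a => by simp

theorem PrimrecRel.forall_le_bound {R : ℕ → α → Prop} {b : α → ℕ} (hR : PrimrecRel R)
    (hb : Primrec b) : PrimrecPred fun a => ∀ n ≤ b a, R n a :=
  (hR.forall_mem_list.comp (list_range.comp (succ.comp hb)) Primrec.id).of_eq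
    fun a => by simp

theorem primrec_images : Primrec₂ images :=
  (Primrec.cond snd (snd.comp fst) (fst.comp fst)).to₂

theorem primrec_substWord : Primrec₂ fun B w => substWord (images B) w :=
  (list_flatMap snd (primrec_images.comp (fst.comp fst) snd).to₂).to₂

theorem primrec_iterWord : Primrec₂ fun B k => iterWord (images B) k :=
  (nat_iterate snd (Primrec.const [false])
    (primrec_substWord.comp (fst.comp fst) snd).to₂).to₂

theorem primrec_count (c : Letter) : Primrec fun w : List Letter => w.count c :=
  (list_length.comp (listFilter (p := fun x : Letter => x = c)
    (Primrec.eq.comp Primrec.id (Primrec.const c)))).of_eq fun w => by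
      rw [List.count_eq_length_filter]
      congr 1

theorem primrec_listPow : Primrec₂ listPow :=
  (list_flatten.comp (list_map (list_range.comp snd) (fst.comp fst).to₂)).to₂.of_eq
    fun z n => by simp [listPow]

theorem primrecPred_periodicCriterion : PrimrecPred PeriodicCriterion := by
  have hW : Primrec fun B => iterWord (images B) 2 :=
    primrec_iterWord.comp Primrec.id (Primrec.const 2)
  have hz : Primrec fun a : ℕ × (List Letter × List Letter) =>
      (iterWord (images a.2) 2).take a.1 := list_take.comp fst (hW.comp snd)
  have hF := primrec_substWord.comp snd hz
  refine PrimrecRel.exists_le_bound (PrimrecPred.and ?_ ?_) (list_length.comp hW)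
  · exact nat_lt.comp (Primrec.const 0) fst
  · exact Primrec.eq.comp (primrec_listPow.comp hF fst)
      (primrec_listPow.comp hz (list_length.comp hF))

theorem primrecPred_singularCriterion : PrimrecPred SingularCriterion := by
  have hc1 : ∀ c, Primrec fun B : List Letter × List Letter => B.1.count c :=
    fun c => (primrec_count c).comp fst
  have hc2 : ∀ c, Primrec fun B : List Letter × List Letter => B.2.count c :=
    fun c => (primrec_count c).comp snd
  refine PrimrecPred.and ?_ (PrimrecRel.exists_le_bound (PrimrecPred.and ?_ ?_) ?_)
  · exact Primrec.eq.comp (nat_mul.comp (hc1 false) (hc2 true))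
      (nat_mul.comp (hc2 false) (hc1 true))
  · exact nat_lt.comp (Primrec.const 0) fst
  · have hW : Primrec fun a : ℕ × (List Letter × List Letter) =>
        iterWord (images a.2) (2 * a.1 + 1) :=
      primrec_iterWord.comp snd (succ.comp (nat_mul.comp (Primrec.const 2) fst))
    have ht : Primrec fun a : ℕ × (ℕ × (List Letter × List Letter)) =>
        (iterWord (images a.2.2) (2 * a.2.1 + 1)).take a.1 := list_take.comp fst (hW.comp snd)
    refine PrimrecRel.forall_le_bound ?_ (list_length.comp hW)
    have h1 : PrimrecPred fun a : ℕ × (ℕ × (List Letter × List Letter)) => a.1 % a.2.1 = 0 :=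
      Primrec.eq.comp (nat_mod.comp fst (fst.comp snd)) (Primrec.const 0)
    have h2 : PrimrecPred fun a : ℕ × (ℕ × (List Letter × List Letter)) =>
        a.2.2.1.count true * ((iterWord (images a.2.2) (2 * a.2.1 + 1)).take a.1).count false =
        a.2.2.1.count false * ((iterWord (images a.2.2) (2 * a.2.1 + 1)).take a.1).count true :=
      Primrec.eq.comp
        (nat_mul.comp ((hc1 true).comp (snd.comp snd)) ((primrec_count false).comp ht))
        (nat_mul.comp ((hc1 false).comp (snd.comp snd)) ((primrec_count true).comp ht))
    exact (h1.not.or h2).of_eq fun a => imp_iff_not_or.symm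
  · exact list_length.comp (primrec_iterWord.comp Primrec.id
      (nat_add.comp (nat_add.comp (list_length.comp fst) (list_length.comp snd))
        (Primrec.const 3)))

end Computability

/-- There is one algorithm that, given the blocks `f(a)`, `f(b)` of any morphism `f` of `{a, b}*`
prolongable on `a`, decides whether `f^ω(a)` is purely abelian periodic. -/
theorem mainTheorem6 :
    ∃ decider : List Letter × List Letter → Bool, Computable decider ∧
      ∀ f : Morphism, IsProlongable f →
        (decider (blocks f) = true ↔ IsPurelyAbelianPeriodic (omegaWord f)) := by
  obtain ⟨_, hdec⟩ := primrecPred_periodicCriterion.or primrecPred_singularCriterion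
  refine ⟨_, hdec.to_comp, fun f hf => ?_⟩
  rw [decide_eq_true_iff]
  exact (generates_omegaWord hf).isPurelyAbelianPeriodic_iff.symm
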